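/- For a group $G$ and a finite generating set $S=S^{-1}$ of $G$, let $M$ be the Markov operator of the simple random walk on the Cayley graph of $(G,S)$, that is, the bounded operator on the complex Hilbert space $\ell^2(G)$ given by $$(Mf)(g)=\frac{1}{|S|}\sum_{s\in S}f(s^{-1}g);$$ its spectrum is called the spectrum of $G$ (with respect to $S$). There is a family of groups, indexed by a set of the cardinality of the continuum, whose members are pairwise non-isomorphic and such that each member $G$ is torsion-free (no element other than $1$ has finite order), solvable of derived length exactly $3$ (that is, $G^{(3)}=1$ and $G^{(2)}\neq 1$), and generated by two elements $a,b$ such that the spectrum of $G$ with respect to $S=\{a,a^{-1},b,b^{-1}\}$ is equal to $[-1,1]$. -/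

import Mathlib

noncomputable section

/-- The complex Hilbert space `ℓ²(G)`. -/
abbrev EllTwo (G : Type*) : Type _ := lp (fun _ : G => ℂ) 2

theorem hasSum_translate {G : Type*} [Group G] (g : G) (f : EllTwo G) :
    HasSum (fun h : G => ‖f (g⁻¹ * h)‖ ^ (2 : ENNReal).toReal) (‖f‖ ^ (2 : ENNReal).toReal) :=
  (Equiv.mulLeft g⁻¹).hasSum_iff.2 (lp.hasSum_norm (by norm_num) f)

/-- The left regular representation: `(leftRegular g f) h = f (g⁻¹ h)`, an isometry of `ℓ²(G)`. -/
def leftRegular {G : Type*} [Group G] (g : G) : EllTwo G →ₗᵢ[ℂ] EllTwo G where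
  toFun f := ⟨fun h => f (g⁻¹ * h), memℓp_gen (hasSum_translate g f).summable⟩
  map_add' _ _ := rfl
  map_smul' _ _ := rfl
  norm_map' f := by
    have h := (lp.hasSum_norm (p := 2) (by norm_num)
      (⟨fun h => f (g⁻¹ * h), memℓp_gen (hasSum_translate g f).summable⟩ : EllTwo G)).unique
      (hasSum_translate g f)
    exact (Real.rpow_left_inj (norm_nonneg _) (norm_nonneg _) (by norm_num)).1 h

/-- The Markov operator of the simple random walk on the Cayley graph of `G` with respect to a
finite set `S`, as a bounded operator on `ℓ²(G)`. -/
def markovOperator {G : Type*} [Group G] (S : Finset G) : EllTwo G →L[ℂ] EllTwo G :=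
  (S.card : ℂ)⁻¹ • ∑ s ∈ S, (leftRegular s).toContinuousLinearMap

theorem markovOperator_apply {G : Type*} [Group G] (S : Finset G) (f : EllTwo G) (g : G) :
    markovOperator S f g = (S.card : ℂ)⁻¹ * ∑ s ∈ S, f (s⁻¹ * g) := by
  have h (T : Finset G) : (∑ s ∈ T, leftRegular s f : EllTwo G) g = ∑ s ∈ T, f (s⁻¹ * g) := by
    classical
    induction T using Finset.induction_on with
    | empty => rfl
    | insert a T ha ih =>
      rw [Finset.sum_insert ha, Finset.sum_insert ha, ← ih]
      rfl
  rw [← h S, markovOperator, _root_.smul_apply, _root_.sum_apply]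
  rfl

/-- The spectrum of a group with finite symmetric generating set `S`: the spectrum of the Markov
operator in the algebra of bounded operators on `ℓ²(G)`. -/
def groupSpectrum {G : Type*} [Group G] (S : Finset G) : Set ℂ :=
  spectrum ℂ (markovOperator S)

open Classical in
/-- The symmetric set `{a, a⁻¹, b, b⁻¹}`. -/
def symmetricPair {G : Type*} [Group G] (a b : G) : Finset G := {a, a⁻¹, b, b⁻¹}

/-- No element other than `1` has finite order. -/
def IsTorsionFreeGroup (G : Type*) [Group G] : Prop :=
  ∀ g : G, IsOfFinOrder g → g = 1

end

open scoped LaurentPolynomial commutatorElement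

/-! The groups are of Hall type: lamps indexed by `ℤ`, permuted by a shift, generate a class-two
nilpotent group whose commutators lie in a central `ℤ`. By `HallGroup.commute_lampGen_iff`, the
lamps at distance `n` commute exactly when `w n = w (-n)`, so `w` can encode an arbitrary `A : Set
ℕ`.

The pair of generators determines `A` up to isomorphism (`noncommutingShifts_map`,
`noncommutingShifts_hallGroup`). A countable group has only countably many pairs, so every
isomorphism class contains countably many `A`, and continuum many classes remain.

The Markov operator is a self-adjoint contraction, so its spectrum lies in `[-1, 1]`. Conversely,
some character sends both generators to any prescribed `z` on the circle. Its inverse cut off to a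
Følner set is an approximate eigenvector with eigenvalue `re z`
(`re_mem_groupSpectrum_of_almostInvariant`), and `re z` runs over `[-1, 1]`. -/

/-! ### The Markov operator as a self-adjoint contraction, and approximate eigenvectors -/

theorem leftRegular_apply {G : Type*} [Group G] (g : G) (f : EllTwo G) (h : G) :
    leftRegular g f h = f (g⁻¹ * h) := rfl

theorem leftRegular_mul_inv {G : Type*} [Group G] (g : G) (f : EllTwo G) :
    leftRegular g (leftRegular g⁻¹ f) = f := by
  ext h
  simp [leftRegular_apply]

theorem inner_leftRegular_left {G : Type*} [Group G] (g : G) (e f : EllTwo G) :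
    inner ℂ (leftRegular g e) f = inner ℂ e (leftRegular g⁻¹ f) := by
  conv_lhs => rw [← leftRegular_mul_inv g f]
  exact LinearIsometry.inner_map_map _ _ _

theorem norm_markovOperator_le {G : Type*} [Group G] (S : Finset G) :
    ‖markovOperator S‖ ≤ 1 := by
  rw [markovOperator, norm_smul, norm_inv, Complex.norm_natCast]
  have h : ‖∑ s ∈ S, (leftRegular s).toContinuousLinearMap‖ ≤ S.card • (1 : ℝ) :=
    (norm_sum_le _ _).trans (Finset.sum_le_card_nsmul _ _ _ fun s _ =>
      LinearIsometry.norm_toContinuousLinearMap_le _)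
  rw [nsmul_eq_mul, mul_one] at h
  exact (mul_le_mul_of_nonneg_left h (by positivity)).trans inv_mul_le_one

theorem isSelfAdjoint_markovOperator {G : Type*} [Group G] {S : Finset G}
    (hS : ∀ s ∈ S, s⁻¹ ∈ S) : IsSelfAdjoint (markovOperator S) := by
  refine LinearMap.IsSymmetric.isSelfAdjoint fun e f => ?_
  have h (f : EllTwo G) :
      markovOperator S f = (S.card : ℂ)⁻¹ • ∑ s ∈ S, leftRegular s f := by
    rw [markovOperator, _root_.smul_apply, _root_.sum_apply]
    rfl
  change inner ℂ (markovOperator S e) f = inner ℂ e (markovOperator S f)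
  rw [h, h, inner_smul_left, inner_smul_right, sum_inner, inner_sum, map_inv₀, Complex.conj_natCast]
  congr 1
  refine Finset.sum_bij' (fun s _ => s⁻¹) (fun s _ => s⁻¹) hS hS (by simp) (by simp) fun s _ => ?_
  exact inner_leftRegular_left s e f

theorem groupSpectrum_subset {G : Type*} [Group G] {S : Finset G} (hS : ∀ s ∈ S, s⁻¹ ∈ S) :
    groupSpectrum S ⊆ Complex.ofReal '' Set.Icc (-1 : ℝ) 1 := by
  intro z hz
  have hre : z = z.re := (isSelfAdjoint_markovOperator hS).mem_spectrum_eq_re hz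
  refine ⟨z.re, abs_le.1 ?_, hre.symm⟩
  have : Nontrivial (EllTwo G) := by
    by_contra h
    rw [not_nontrivial_iff_subsingleton] at h
    have : Subsingleton (EllTwo G →L[ℂ] EllTwo G) := inferInstance
    rw [groupSpectrum, spectrum.of_subsingleton] at hz
    exact hz
  have h := (spectrum.norm_le_norm_of_mem hz).trans (norm_markovOperator_le S)
  rw [hre, Complex.norm_real] at h
  exact h

/-- A complex number admitting approximate eigenvectors lies in the spectrum. -/
theorem mem_spectrum_of_approx {E : Type*} [NormedAddCommGroup E] [NormedSpace ℂ E]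
    (A : E →L[ℂ] E) (z : ℂ) (h : ∀ ε > 0, ∃ f : E, f ≠ 0 ∧ ‖A f - z • f‖ ≤ ε * ‖f‖) :
    z ∈ spectrum ℂ A := by
  intro hu
  obtain ⟨u, hu⟩ := hu
  set B : E →L[ℂ] E := ((u⁻¹ : (E →L[ℂ] E)ˣ) : E →L[ℂ] E)
  have hB (f : E) : B (z • f - A f) = f := by
    have h1 : B * (u : E →L[ℂ] E) = 1 := u.inv_mul
    rw [hu] at h1
    simpa [Algebra.algebraMap_eq_smul_one] using congr($h1 f)
  -- This tolerance makes the inverse `B` give `‖f‖ ≤ ‖f‖ / 2`; the `+ 1` covers `‖B‖ = 0`.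
  obtain ⟨f, hf, hle⟩ := h (1 / (2 * (‖B‖ + 1))) (by positivity)
  have h2 : ‖f‖ ≤ ‖B‖ * (1 / (2 * (‖B‖ + 1)) * ‖f‖) := by
    calc ‖f‖ = ‖B (z • f - A f)‖ := by rw [hB]
      _ ≤ ‖B‖ * ‖z • f - A f‖ := B.le_opNorm _
      _ ≤ _ := by rw [norm_sub_rev]; gcongr
  have h3 : ‖B‖ * (1 / (2 * (‖B‖ + 1)) * ‖f‖) ≤ 1 / 2 * ‖f‖ := by
    have : ‖B‖ * (1 / (2 * (‖B‖ + 1))) ≤ 1 / 2 := by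
      rw [mul_one_div, div_le_div_iff₀ (by positivity) (by positivity)]
      linarith
    rw [← mul_assoc]
    gcongr
  have := norm_pos_iff.2 hf
  linarith

theorem inv_mem_symmetricPair {G : Type*} [Group G] (a b : G) :
    ∀ s ∈ symmetricPair a b, s⁻¹ ∈ symmetricPair a b := by
  simp only [symmetricPair, Finset.mem_insert, Finset.mem_singleton]
  rintro s (rfl | rfl | rfl | rfl) <;> simp

/-- An approximate eigenvector for `a` and `b` with eigenvalue `z` is one for their inverses with
eigenvalue `z⁻¹`, and the average of `z, z⁻¹, z, z⁻¹` is `re z`. The inequalities make the four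
elements distinct, so that all have weight `1 / 4`. -/
theorem mem_groupSpectrum_symmetricPair {G : Type*} [Group G] {a b : G}
    (h1 : a ≠ a⁻¹) (h2 : a ≠ b) (h3 : a ≠ b⁻¹) (h6 : b ≠ b⁻¹) (z : Circle)
    (h : ∀ ε > 0, ∃ f : EllTwo G, f ≠ 0 ∧ ‖leftRegular a f - (z : ℂ) • f‖ ≤ ε * ‖f‖ ∧
      ‖leftRegular b f - (z : ℂ) • f‖ ≤ ε * ‖f‖) :
    ((z : ℂ).re : ℂ) ∈ groupSpectrum (symmetricPair a b) := by
  classical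
  refine mem_spectrum_of_approx _ _ fun ε hε => ?_
  obtain ⟨f, hf, ha, hb⟩ := h ε hε
  refine ⟨f, hf, ?_⟩
  have hinv (g : G) : ‖leftRegular g⁻¹ f - ((z⁻¹ : Circle) : ℂ) • f‖ =
      ‖leftRegular g f - (z : ℂ) • f‖ := by
    rw [← (leftRegular g).norm_map, map_sub, map_smul, leftRegular_mul_inv, norm_sub_rev]
    rw [← one_mul ‖_ - f‖, ← Circle.norm_coe z, ← norm_smul, smul_sub, smul_smul, ← Circle.coe_mul]
    simp
  have hM : markovOperator (symmetricPair a b) f = (4 : ℂ)⁻¹ • (leftRegular a f +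
      leftRegular a⁻¹ f + leftRegular b f + leftRegular b⁻¹ f) := by
    have h4 : a⁻¹ ≠ b := fun h => h3 (by rw [← h, inv_inv])
    have h5 : a⁻¹ ≠ b⁻¹ := fun h => h2 (inv_injective h)
    have hcard : (symmetricPair a b).card = 4 := by
      rw [symmetricPair, Finset.card_insert_of_notMem (by simp [h1, h2, h3]),
        Finset.card_insert_of_notMem (by simp [h4, h5]), Finset.card_pair h6]
    rw [markovOperator, hcard, _root_.smul_apply, _root_.sum_apply, symmetricPair]
    rw [Finset.sum_insert (by simp [h1, h2, h3]), Finset.sum_insert (by simp [h4, h5]),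
      Finset.sum_insert (by simp [h6]), Finset.sum_singleton]
    simp [add_assoc]
  have hz : ((z : ℂ).re : ℂ) • f = (4 : ℂ)⁻¹ • ((z : ℂ) • f + ((z⁻¹ : Circle) : ℂ) • f +
      (z : ℂ) • f + ((z⁻¹ : Circle) : ℂ) • f) := by
    rw [← add_smul, ← add_smul, ← add_smul, smul_smul, Circle.coe_inv_eq_conj,
      Complex.re_eq_add_conj]
    congr 1
    ring
  rw [hM, hz, ← smul_sub, norm_smul]
  have he : leftRegular a f + leftRegular a⁻¹ f + leftRegular b f + leftRegular b⁻¹ f -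
      ((z : ℂ) • f + ((z⁻¹ : Circle) : ℂ) • f + (z : ℂ) • f + ((z⁻¹ : Circle) : ℂ) • f) =
      (leftRegular a f - (z : ℂ) • f) + (leftRegular a⁻¹ f - ((z⁻¹ : Circle) : ℂ) • f) +
      (leftRegular b f - (z : ℂ) • f) + (leftRegular b⁻¹ f - ((z⁻¹ : Circle) : ℂ) • f) := by
    abel
  rw [he]
  have h4 := norm_add₄_le (a := leftRegular a f - (z : ℂ) • f)
    (b := leftRegular a⁻¹ f - ((z⁻¹ : Circle) : ℂ) • f)
    (c := leftRegular b f - (z : ℂ) • f) (d := leftRegular b⁻¹ f - ((z⁻¹ : Circle) : ℂ) • f)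
  rw [hinv, hinv] at h4
  rw [norm_inv, Complex.norm_ofNat]
  linarith

theorem EllTwo.norm_sq_eq_card {G : Type*} [DecidableEq G] (f : EllTwo G) (D : Finset G)
    (h : ∀ g, ‖f g‖ = if g ∈ D then 1 else 0) : ‖f‖ ^ 2 = D.card := by
  have h1 := lp.norm_rpow_eq_tsum (p := 2) (by norm_num) f
  have h2 (g : G) : ‖f g‖ ^ (2 : ENNReal).toReal = if g ∈ D then 1 else 0 := by
    rw [h]; split_ifs <;> norm_num
  simp_rw [h2] at h1
  rw [tsum_eq_sum (s := D) (by intro g hg; simp [hg])] at h1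
  simpa using h1

/-! ### Characters cut off to almost invariant sets -/

/-- The inverse of a unitary character, cut off outside of a finite set. -/
noncomputable def cutoffCharacter {G : Type*} [Group G] [DecidableEq G] (χ : G →* Circle)
    (F : Finset G) : EllTwo G :=
  ⟨fun g => if g ∈ F then ((χ g)⁻¹ : Circle) else 0,
    (memℓp_zero ((Finset.finite_toSet F).subset fun g hg => by
      by_contra h
      exact hg (if_neg h))).of_exponent_ge (by simp)⟩

theorem cutoffCharacter_apply {G : Type*} [Group G] [DecidableEq G] (χ : G →* Circle)
    (F : Finset G) (g : G) :
    cutoffCharacter χ F g = if g ∈ F then (((χ g)⁻¹ : Circle) : ℂ) else 0 := rfl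

theorem norm_sq_cutoffCharacter {G : Type*} [Group G] [DecidableEq G] (χ : G →* Circle)
    (F : Finset G) : ‖cutoffCharacter χ F‖ ^ 2 = F.card := by
  refine EllTwo.norm_sq_eq_card _ _ fun g => ?_
  rw [cutoffCharacter_apply]
  split_ifs <;> simp [Circle.norm_coe]

/-- On `F ∩ sF` the difference vanishes because `χ` is multiplicative. On the symmetric difference
it has modulus one, and the two halves are equinumerous since `sF` and `F` are. -/
theorem norm_sq_leftRegular_cutoffCharacter_sub {G : Type*} [Group G] [DecidableEq G]
    (χ : G →* Circle) (F : Finset G) (s : G) :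
    ‖leftRegular s (cutoffCharacter χ F) - (χ s : ℂ) • cutoffCharacter χ F‖ ^ 2 =
      2 * (F.filter (s * · ∉ F)).card := by
  have hF : (F.image (s * ·)).card = F.card :=
    Finset.card_image_of_injective _ (mul_right_injective s)
  have hmem (g : G) : g ∈ F.image (s * ·) ↔ s⁻¹ * g ∈ F := by
    simp
  have h1 : (F.image (s * ·) \ F).card = (F.filter (s * · ∉ F)).card := by
    rw [← Finset.card_image_of_injective (F.filter (s * · ∉ F)) (mul_right_injective s)]
    congr 1
    ext g
    simp only [Finset.mem_sdiff, Finset.mem_image, Finset.mem_filter]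
    constructor
    · rintro ⟨⟨h, hh, rfl⟩, h'⟩
      exact ⟨h, ⟨hh, h'⟩, rfl⟩
    · rintro ⟨h, ⟨hh, h'⟩, rfl⟩
      exact ⟨⟨h, hh, rfl⟩, h'⟩
  have h2 : (F \ F.image (s * ·)).card = (F.filter (s * · ∉ F)).card := by
    rw [← h1, Finset.card_sdiff_comm hF]
  rw [EllTwo.norm_sq_eq_card _ ((F.image (s * ·) \ F) ∪ (F \ F.image (s * ·))),
    Finset.card_union_of_disjoint disjoint_sdiff_sdiff, h1, h2]
  · push_cast; ring
  · intro g
    have : (leftRegular s (cutoffCharacter χ F) - (χ s : ℂ) • cutoffCharacter χ F : EllTwo G) g =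
        leftRegular s (cutoffCharacter χ F) g - (χ s : ℂ) * cutoffCharacter χ F g := rfl
    rw [this, leftRegular_apply, cutoffCharacter_apply, cutoffCharacter_apply]
    simp only [Finset.mem_union, Finset.mem_sdiff, hmem]
    by_cases h3 : s⁻¹ * g ∈ F <;> by_cases h4 : g ∈ F <;> simp [h3, h4, mul_comm, Circle.norm_coe]

/-- If a character takes the same value `z` at `a` and `b`, and there are finite sets which are
almost invariant under `a` and `b`, then `re z` is in the spectrum. -/
theorem re_mem_groupSpectrum_of_almostInvariant {G : Type*} [Group G] [DecidableEq G] {a b : G}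
    (h1 : a ≠ a⁻¹) (h2 : a ≠ b) (h3 : a ≠ b⁻¹) (h6 : b ≠ b⁻¹) (χ : G →* Circle) (hχ : χ a = χ b)
    (hF : ∀ ε > (0 : ℝ), ∃ F : Finset G, F.Nonempty ∧
      (F.filter (a * · ∉ F)).card ≤ ε * F.card ∧ (F.filter (b * · ∉ F)).card ≤ ε * F.card) :
    ((χ a : ℂ).re : ℂ) ∈ groupSpectrum (symmetricPair a b) := by
  refine mem_groupSpectrum_symmetricPair h1 h2 h3 h6 _ fun ε hε => ?_
  obtain ⟨F, hne, ha, hb⟩ := hF (ε ^ 2 / 2) (by positivity)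
  have hs (s : G) (h : (F.filter (s * · ∉ F)).card ≤ ε ^ 2 / 2 * F.card) :
      ‖leftRegular s (cutoffCharacter χ F) - (χ s : ℂ) • cutoffCharacter χ F‖ ≤
        ε * ‖cutoffCharacter χ F‖ := by
    refine le_of_sq_le_sq ?_ (by positivity)
    rw [norm_sq_leftRegular_cutoffCharacter_sub, mul_pow, norm_sq_cutoffCharacter]
    linarith
  refine ⟨cutoffCharacter χ F, fun h => ?_, hs a ha, hχ ▸ hs b hb⟩
  have := norm_sq_cutoffCharacter χ F
  rw [h] at this
  simp [eq_comm, hne.ne_empty] at this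

/-! ### The translation-invariant form and the Hall groups -/

/-- The additive functional on integral Laurent polynomials sending `T ^ n` to `w n`. -/
noncomputable def laurentFunctional (w : ℤ → ℤ) : ℤ[T;T⁻¹] →+ ℤ :=
  (Finsupp.linearCombination ℤ w).toAddMonoidHom.comp
    (AddMonoidAlgebra.coeffAddEquiv : ℤ[T;T⁻¹] ≃+ (ℤ →₀ ℤ)).toAddMonoidHom

open LaurentPolynomial in
@[simp] theorem laurentFunctional_T (w : ℤ → ℤ) (n : ℤ) : laurentFunctional w (T n) = w n := by
  change Finsupp.linearCombination ℤ w (Finsupp.single n 1) = w n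
  rw [Finsupp.linearCombination_single, one_smul]

/-- The biadditive form on integral Laurent polynomials with
`laurentForm w (T m) (T n) = w (n - m)`. -/
noncomputable def laurentForm (w : ℤ → ℤ) (p q : ℤ[T;T⁻¹]) : ℤ :=
  laurentFunctional w (LaurentPolynomial.invert p * q)

namespace laurentForm

variable (w : ℤ → ℤ) (p q r : ℤ[T;T⁻¹]) (k m n : ℤ)

@[simp] theorem add_left : laurentForm w (p + q) r = laurentForm w p r + laurentForm w q r := by
  simp [laurentForm, add_mul]

@[simp] theorem add_right : laurentForm w p (q + r) = laurentForm w p q + laurentForm w p r := by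
  simp [laurentForm, mul_add]

@[simp] theorem neg_left : laurentForm w (-p) q = -laurentForm w p q := by
  simp [laurentForm]

@[simp] theorem neg_right : laurentForm w p (-q) = -laurentForm w p q := by
  simp [laurentForm]

@[simp] theorem zero_left : laurentForm w 0 q = 0 := by simp [laurentForm]

@[simp] theorem zero_right : laurentForm w p 0 = 0 := by simp [laurentForm]

@[simp] theorem T_T : laurentForm w (.T m) (.T n) = w (n - m) := by
  rw [laurentForm, LaurentPolynomial.invert_T, ← LaurentPolynomial.T_add, laurentFunctional_T]
  congr 1
  ring

-- Inversion turns `T k` into its inverse. This invariance lets the shift act by automorphisms on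
-- the central extension, and so gives associativity in `HallGroup`.
@[simp] theorem mul_T_mul_T :
    laurentForm w (p * .T k) (q * .T k) = laurentForm w p q := by
  have h : (LaurentPolynomial.T (-k) : ℤ[T;T⁻¹]) * .T k = 1 := by
    rw [← LaurentPolynomial.T_add, neg_add_cancel, LaurentPolynomial.T_zero]
  rw [laurentForm, laurentForm, map_mul LaurentPolynomial.invert, LaurentPolynomial.invert_T, mul_mul_mul_comm, h, mul_one]

end laurentForm

/-- A group of Hall type: the extension by the infinite cyclic shift group of the class-two
nilpotent group which is the central extension of `ℤ[T;T⁻¹]` by `ℤ` with cocycle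
`laurentForm w`. -/
@[ext] structure HallGroup (w : ℤ → ℤ) where
  /-- the exponent of the shift -/
  shift : ℤ
  /-- the image in the lamp group -/
  poly : ℤ[T;T⁻¹]
  /-- the central coordinate -/
  central : ℤ

namespace HallGroup

variable {w : ℤ → ℤ}

noncomputable instance : Mul (HallGroup w) :=
  ⟨fun g h => ⟨g.shift + h.shift, g.poly + h.poly * .T g.shift,
    g.central + h.central + laurentForm w g.poly (h.poly * .T g.shift)⟩⟩

noncomputable instance : One (HallGroup w) := ⟨⟨0, 0, 0⟩⟩

noncomputable instance : Inv (HallGroup w) :=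
  ⟨fun g => ⟨-g.shift, -(g.poly * .T (-g.shift)), -g.central + laurentForm w g.poly g.poly⟩⟩

@[simp] theorem shift_mul (g h : HallGroup w) : (g * h).shift = g.shift + h.shift := rfl
@[simp] theorem poly_mul (g h : HallGroup w) : (g * h).poly = g.poly + h.poly * .T g.shift := rfl
@[simp] theorem central_mul (g h : HallGroup w) : (g * h).central =
    g.central + h.central + laurentForm w g.poly (h.poly * .T g.shift) := rfl
@[simp] theorem shift_one : (1 : HallGroup w).shift = 0 := rfl
@[simp] theorem poly_one : (1 : HallGroup w).poly = 0 := rfl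
@[simp] theorem central_one : (1 : HallGroup w).central = 0 := rfl
@[simp] theorem shift_inv (g : HallGroup w) : g⁻¹.shift = -g.shift := rfl
@[simp] theorem poly_inv (g : HallGroup w) : g⁻¹.poly = -(g.poly * .T (-g.shift)) := rfl
@[simp] theorem central_inv (g : HallGroup w) :
    g⁻¹.central = -g.central + laurentForm w g.poly g.poly := rfl

noncomputable instance : Group (HallGroup w) :=
  Group.ofLeftAxioms
    (by
      intro g h k
      ext1
      · simp [add_assoc]
      · simp [add_mul, add_assoc, add_comm h.shift]
      · simp only [central_mul, poly_mul, shift_mul, add_mul, LaurentPolynomial.mul_T_assoc,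
          laurentForm.add_left, laurentForm.add_right, ← laurentForm.mul_T_mul_T w h.poly _ g.shift,
          add_comm h.shift]
        ring)
    (by intro g; ext1 <;> simp)
    (by
      intro g
      ext1
      · simp
      · simp
      · simp only [central_mul, central_inv, shift_inv, poly_inv, laurentForm.neg_left,
          laurentForm.mul_T_mul_T, central_one]
        ring)

/-- The exponent of the shift, as a homomorphism. -/
def shiftHom : HallGroup w →* Multiplicative ℤ where
  toFun g := .ofAdd g.shift
  map_one' := rfl
  map_mul' _ _ := rfl

/-! ### The two generators -/

/-- The generator acting as the shift. -/
noncomputable def shiftGen (w : ℤ → ℤ) : HallGroup w := ⟨1, 0, 0⟩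

/-- The generator of the lamp group at the origin. -/
noncomputable def lampGen (w : ℤ → ℤ) : HallGroup w := ⟨0, 1, 0⟩

theorem shiftGen_zpow (n : ℤ) : shiftGen w ^ n = ⟨n, 0, 0⟩ := by
  let f : Multiplicative ℤ →* HallGroup w :=
    { toFun := fun n => ⟨n.toAdd, 0, 0⟩
      map_one' := rfl
      map_mul' := fun a b => by ext1 <;> simp }
  have h := (map_zpow f (.ofAdd 1) n).symm
  rw [← ofAdd_zsmul] at h
  simpa [f, shiftGen] using h

theorem shiftGen_conj_lampGen (n : ℤ) :
    shiftGen w ^ n * lampGen w * (shiftGen w ^ n)⁻¹ = ⟨0, .T n, 0⟩ := by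
  rw [shiftGen_zpow]
  ext1 <;> simp [lampGen]

theorem commute_lampGen_iff (n : ℤ) :
    Commute (lampGen w) (shiftGen w ^ n * lampGen w * (shiftGen w ^ n)⁻¹) ↔ w n = w (-n) := by
  rw [shiftGen_conj_lampGen, commute_iff_eq, HallGroup.ext_iff]
  have h : (1 : ℤ[T;T⁻¹]) = .T 0 := LaurentPolynomial.T_zero.symm
  simp only [lampGen, h, shift_mul, poly_mul, central_mul, laurentForm.T_T,
    ← LaurentPolynomial.T_add]
  simp [add_comm]

/-- The commutator of the lamps at `0` and `1` is central with coordinate `w 1 - w (-1) = 1`, hence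
generates the centre coordinate. -/
theorem central_mem_closure (hw : w 1 - w (-1) = 1) (c : ℤ) :
    (⟨0, 0, c⟩ : HallGroup w) ∈ Subgroup.closure {shiftGen w, lampGen w} := by
  have ht : shiftGen w ∈ Subgroup.closure {shiftGen w, lampGen w} :=
    Subgroup.subset_closure (by simp)
  have hx : lampGen w ∈ Subgroup.closure {shiftGen w, lampGen w} :=
    Subgroup.subset_closure (by simp)
  have hy := Subgroup.mul_mem _ (Subgroup.mul_mem _ (Subgroup.zpow_mem _ ht 1) hx)
    (Subgroup.inv_mem _ (Subgroup.zpow_mem _ ht 1))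
  rw [shiftGen_conj_lampGen] at hy
  let f : Multiplicative ℤ →* HallGroup w :=
    { toFun := fun n => ⟨0, 0, n.toAdd⟩
      map_one' := rfl
      map_mul' := fun a b => by ext1 <;> simp }
  have hz : lampGen w * ⟨0, .T 1, 0⟩ * (lampGen w)⁻¹ * (⟨0, .T 1, 0⟩ : HallGroup w)⁻¹ =
      ⟨0, 0, 1⟩ := by
    have h : (1 : ℤ[T;T⁻¹]) = .T 0 := LaurentPolynomial.T_zero.symm
    rw [mul_inv_eq_iff_eq_mul, mul_inv_eq_iff_eq_mul]
    ext1
    · simp [lampGen]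
    · simp [lampGen, add_comm]
    · simp only [lampGen, h, central_mul, poly_mul, shift_mul, ← LaurentPolynomial.T_add,
        laurentForm.add_left, laurentForm.zero_left, laurentForm.T_T]
      norm_num
      omega
  have hf : (⟨0, 0, c⟩ : HallGroup w) = ⟨0, 0, 1⟩ ^ c := by
    have h := map_zpow f (.ofAdd 1) c
    rw [← ofAdd_zsmul] at h
    simpa [f] using h
  rw [hf, ← hz]
  exact Subgroup.zpow_mem _ (Subgroup.mul_mem _ (Subgroup.mul_mem _ (Subgroup.mul_mem _ hx hy)
    (Subgroup.inv_mem _ hx)) (Subgroup.inv_mem _ hy)) c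

theorem closure_eq_top (hw : w 1 - w (-1) = 1) :
    Subgroup.closure {shiftGen w, lampGen w} = ⊤ := by
  set H := Subgroup.closure {shiftGen w, lampGen w}
  have ht : shiftGen w ∈ H := Subgroup.subset_closure (by simp)
  have hx : lampGen w ∈ H := Subgroup.subset_closure (by simp)
  -- Central coordinates can be adjusted freely inside `H`, so the cocycle may be ignored and the
  -- lamp parts form a subgroup `K`.
  have hc (v : ℤ[T;T⁻¹]) (c d : ℤ) (h : (⟨0, v, c⟩ : HallGroup w) ∈ H) :
      (⟨0, v, d⟩ : HallGroup w) ∈ H := by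
    convert H.mul_mem h (central_mem_closure hw (d - c)) using 1
    ext1 <;> simp
  let K : AddSubgroup ℤ[T;T⁻¹] :=
    { carrier := {v | (⟨0, v, 0⟩ : HallGroup w) ∈ H}
      zero_mem' := H.one_mem
      add_mem' := fun {u v} hu hv => hc _ (laurentForm w u v) _
        (by
          convert H.mul_mem hu hv using 1
          ext1 <;> simp)
      neg_mem' := fun {u} hu => hc _ (laurentForm w u u) _
        (by
          convert H.inv_mem hu using 1
          ext1 <;> simp) }
  have hK (v : ℤ[T;T⁻¹]) : v ∈ K := by
    induction v using LaurentPolynomial.induction_on' with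
    | add p q hp hq => exact K.add_mem hp hq
    | C_mul_T n a =>
      rw [← LaurentPolynomial.smul_eq_C_mul]
      refine K.zsmul_mem ?_ a
      have h := H.mul_mem (H.mul_mem (H.zpow_mem ht n) hx) (H.inv_mem (H.zpow_mem ht n))
      rwa [shiftGen_conj_lampGen] at h
  refine (Subgroup.eq_top_iff' H).2 fun g => ?_
  convert H.mul_mem (hc g.poly 0 g.central (hK _)) (H.zpow_mem ht g.shift) using 1
  rw [shiftGen_zpow]
  ext1 <;> simp

/-! ### Torsion-freeness and derived length -/

theorem isTorsionFreeGroup : IsTorsionFreeGroup (HallGroup w) := by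
  intro g hg
  obtain ⟨n, hn, h⟩ := isOfFinOrder_iff_pow_eq_one.1 hg
  -- Each coordinate is additive once the previous ones vanish, so torsion is excluded one
  -- coordinate at a time.
  have hs : g.shift = 0 := by
    have h' := congr(shiftHom $h)
    rw [map_pow] at h'
    have : n * g.shift = 0 := by simpa [shiftHom, ← ofAdd_nsmul] using h'
    simpa [hn.ne'] using this
  have hp (m : ℕ) : (g ^ m).poly = m • g.poly := by
    induction m with
    | zero => simp
    | succ m ih => rw [pow_succ', poly_mul, ih, hs, LaurentPolynomial.T_zero, mul_one, succ_nsmul']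
  have hp0 : g.poly = 0 := by
    have h' := hp n
    rw [h, poly_one, eq_comm] at h'
    refine LaurentPolynomial.ext fun i => ?_
    have := congr(($h').coeff i)
    rw [AddMonoidAlgebra.coeff_smul] at this
    simpa [hn.ne', -nsmul_eq_mul] using this
  have hz (m : ℕ) : (g ^ m).central = m * g.central := by
    induction m with
    | zero => simp
    | succ m ih =>
      rw [pow_succ', central_mul, ih, hp0, laurentForm.zero_left]
      push_cast
      ring
  have hz0 : g.central = 0 := by
    have h' := hz n
    rw [h, central_one, eq_comm] at h'
    simpa [hn.ne'] using h'
  ext1 <;> assumption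

theorem derivedSeries_one_le : derivedSeries (HallGroup w) 1 ≤ (shiftHom (w := w)).ker := by
  rw [derivedSeries_one]
  exact Abelianization.commutator_subset_ker _

theorem derivedSeries_two_le {g : HallGroup w} (hg : g ∈ derivedSeries (HallGroup w) 2) :
    g.shift = 0 ∧ g.poly = 0 := by
  let Z : Subgroup (HallGroup w) :=
    { carrier := {g | g.shift = 0 ∧ g.poly = 0}
      one_mem' := ⟨rfl, rfl⟩
      mul_mem' := fun {a b} ha hb => by
        obtain ⟨ha, ha'⟩ := ha
        obtain ⟨hb, hb'⟩ := hb
        simp [ha, ha', hb, hb']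
      inv_mem' := fun {a} ha => by
        obtain ⟨ha, ha'⟩ := ha
        simp [ha, ha'] }
  refine (Subgroup.commutator_le.2 fun a ha b hb => ?_ : derivedSeries (HallGroup w) 2 ≤ Z) hg
  have ha : a.shift = 0 := derivedSeries_one_le ha
  have hb : b.shift = 0 := derivedSeries_one_le hb
  constructor <;> simp [commutatorElement_def, ha, hb]

theorem derivedSeries_three : derivedSeries (HallGroup w) 3 = ⊥ := by
  refine le_bot_iff.1 (Subgroup.commutator_le.2 fun a ha b hb => ?_)
  obtain ⟨ha, ha'⟩ := derivedSeries_two_le ha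
  obtain ⟨hb, hb'⟩ := derivedSeries_two_le hb
  rw [Subgroup.mem_bot, commutatorElement_eq_one_iff_mul_comm]
  ext1 <;> simp [ha, ha', hb, hb', add_comm]

/-- The commutators `y 0`, `y 1` have lamp parts `T - 1` and `T ^ 2 - T`. Their own commutator has
central coordinate `2 * (w 1 - w (-1)) - (w 2 - w (-2))`. -/
theorem derivedSeries_two_ne_bot (hw : 2 * (w 1 - w (-1)) ≠ w 2 - w (-2)) :
    derivedSeries (HallGroup w) 2 ≠ ⊥ := by
  let y (n : ℤ) : HallGroup w := ⁅shiftGen w, shiftGen w ^ n * lampGen w * (shiftGen w ^ n)⁻¹⁆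
  have hy (n : ℤ) : y n ∈ derivedSeries (HallGroup w) 1 :=
    Subgroup.commutator_mem_commutator (Subgroup.mem_top _) (Subgroup.mem_top _)
  have hyn (n : ℤ) : ∃ c, y n = ⟨0, .T (n + 1) + -.T n, c⟩ := by
    refine ⟨_, HallGroup.ext ?_ ?_ rfl⟩
    · simp [y, commutatorElement_def]
    · simp only [y, shiftGen_conj_lampGen]
      simp only [commutatorElement_def, shiftGen, poly_mul, poly_inv, shift_mul, shift_inv,
        ← LaurentPolynomial.T_add]
      simp
  intro h
  have h1 : ⁅y 0, y 1⁆ ∈ derivedSeries (HallGroup w) 2 :=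
    Subgroup.commutator_mem_commutator (hy 0) (hy 1)
  rw [h, Subgroup.mem_bot, commutatorElement_eq_one_iff_mul_comm] at h1
  obtain ⟨c, hc⟩ := hyn 0
  obtain ⟨d, hd⟩ := hyn 1
  rw [hc, hd] at h1
  have h2 := congr(($h1).central)
  simp only [central_mul, LaurentPolynomial.T_zero, mul_one, laurentForm.add_left,
    laurentForm.add_right, laurentForm.neg_left, laurentForm.neg_right, laurentForm.T_T] at h2
  rw [← LaurentPolynomial.T_zero] at h2
  simp only [laurentForm.T_T] at h2
  norm_num at h2
  omega

instance : Countable (HallGroup w) := by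
  have : Countable ℤ[T;T⁻¹] :=
    (AddMonoidAlgebra.coeffEquiv : ℤ[T;T⁻¹] ≃ (ℤ →₀ ℤ)).injective.countable
  refine Function.Injective.countable (β := ℤ × ℤ[T;T⁻¹] × ℤ)
    (f := fun g => (g.shift, g.poly, g.central)) fun g h hgh => ?_
  simp only [Prod.mk.injEq] at hgh
  exact HallGroup.ext hgh.1 hgh.2.1 hgh.2.2

/-! ### Følner sets -/

/-- The element of `HallGroup w` with lamp part `∑ i < N, u i • T ^ (k - i)`. -/
noncomputable def boxElement (w : ℤ → ℤ) (N : ℕ) (p : ℕ × (Fin N → ℕ) × ℕ) : HallGroup w :=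
  ⟨p.1, ∑ i, p.2.1 i • .T ((p.1 : ℤ) - (i : ℕ)), p.2.2⟩

/-- The parameters of the Følner set of size parameter `N`. -/
def boxParameters (N : ℕ) : Finset (ℕ × (Fin N → ℕ) × ℕ) :=
  Finset.range N ×ˢ Fintype.piFinset (fun _ => Finset.range N) ×ˢ Finset.range (N ^ 3)

theorem mem_boxParameters {N : ℕ} {p : ℕ × (Fin N → ℕ) × ℕ} :
    p ∈ boxParameters N ↔ p.1 < N ∧ (∀ i, p.2.1 i < N) ∧ p.2.2 < N ^ 3 := by
  simp [boxParameters]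

theorem card_boxParameters (N : ℕ) : (boxParameters N).card = N * (N ^ N * N ^ 3) := by
  simp [boxParameters]

theorem boxElement_injective (w : ℤ → ℤ) (N : ℕ) : Function.Injective (boxElement w N) := by
  rintro ⟨k, u, c⟩ ⟨l, v, d⟩ h
  have h1 : k = l := by simpa [boxElement] using congr(($h).shift)
  have h2 : c = d := by simpa [boxElement] using congr(($h).central)
  subst h1 h2
  have h3 := congr(($h).poly)
  simp only [boxElement] at h3
  have h4 (u : Fin N → ℕ) (j : Fin N) :
      (∑ i, u i • LaurentPolynomial.T ((k : ℤ) - (i : ℕ)) : ℤ[T;T⁻¹]).coeff (k - (j : ℕ)) =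
        u j := by
    rw [AddMonoidAlgebra.coeff_sum, Finsupp.finsetSum_apply, Finset.sum_eq_single j]
    · rw [AddMonoidAlgebra.coeff_smul, Finsupp.smul_apply, LaurentPolynomial.T_apply]
      simp
    · intro i _ hij
      rw [AddMonoidAlgebra.coeff_smul, Finsupp.smul_apply, LaurentPolynomial.T_apply, if_neg]
      · simp
      · intro h
        exact hij (Fin.ext (by omega))
    · simp
  have h5 : u = v := by
    funext j
    have := h4 u j
    rw [h3, h4] at this
    exact_mod_cast this.symm
  rw [h5]

/-- Lamp positions are recorded relative to the shift `k`, so moving all lamps by one leaves `u`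
unchanged. -/
theorem shiftGen_mul_boxElement (N k : ℕ) (u : Fin N → ℕ) (c : ℕ) :
    shiftGen w * boxElement w N (k, u, c) = boxElement w N (k + 1, u, c) := by
  ext1
  · simp [shiftGen, boxElement, add_comm]
  · simp only [shiftGen, boxElement, poly_mul, zero_add, Finset.sum_mul]
    refine Finset.sum_congr rfl fun i _ => ?_
    rw [smul_mul_assoc, ← LaurentPolynomial.T_add]
    congr 2
    push_cast
    ring
  · simp [shiftGen, boxElement]

/-- The lamp at the origin has index `i = k`. The cocycle adds a sum of `N` terms, each at most `N`,
to the central coordinate; this is small compared with its range `N ^ 3`. -/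
theorem lampGen_mul_boxElement (hw : ∀ n, 0 ≤ w n ∧ w n ≤ 1) {N k : ℕ} (hk : k < N)
    (u : Fin N → ℕ) (c : ℕ) (hu : ∀ i, u i < N) :
    ∃ d ≤ N ^ 2, lampGen w * boxElement w N (k, u, c) =
      boxElement w N (k, Function.update u ⟨k, hk⟩ (u ⟨k, hk⟩ + 1), c + d) := by
  have hsum : laurentForm w 1 (∑ i, u i • .T ((k : ℤ) - (i : ℕ))) =
      ∑ i, u i * w ((k : ℤ) - (i : ℕ)) := by
    rw [laurentForm, map_one, one_mul, map_sum]
    exact Finset.sum_congr rfl fun i _ => by rw [map_nsmul, laurentFunctional_T, nsmul_eq_mul]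
  have h0 : 0 ≤ ∑ i, u i * w ((k : ℤ) - (i : ℕ)) :=
    Finset.sum_nonneg fun i _ => mul_nonneg (by positivity) (hw _).1
  have hle : ∑ i, u i * w ((k : ℤ) - (i : ℕ)) ≤ N ^ 2 := by
    calc ∑ i, u i * w ((k : ℤ) - (i : ℕ)) ≤ ∑ i : Fin N, (N : ℤ) := by
          refine Finset.sum_le_sum fun i _ => ?_
          have h1 : (u i : ℤ) * w ((k : ℤ) - (i : ℕ)) ≤ u i * 1 :=
            mul_le_mul_of_nonneg_left (hw _).2 (by positivity)
          have h2 := hu i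
          omega
      _ = N ^ 2 := by simp [sq]
  refine ⟨(∑ i, u i * w ((k : ℤ) - (i : ℕ))).toNat, by zify; rwa [Int.toNat_of_nonneg h0], ?_⟩
  ext1
  · simp [lampGen, boxElement]
  · simp only [lampGen, boxElement, poly_mul, LaurentPolynomial.T_zero, mul_one]
    rw [← Finset.add_sum_erase _ _ (Finset.mem_univ (⟨k, hk⟩ : Fin N)),
      ← Finset.add_sum_erase _ _ (Finset.mem_univ (⟨k, hk⟩ : Fin N)), Function.update_self,
      succ_nsmul', add_assoc]
    congr 1
    · simp
    · congr 1
      refine Finset.sum_congr rfl fun i hi => ?_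
      rw [Function.update_of_ne (Finset.ne_of_mem_erase hi)]
  · simp only [lampGen, boxElement, central_mul, LaurentPolynomial.T_zero, mul_one, hsum]
    push_cast
    rw [Int.toNat_of_nonneg h0]
    ring

open Classical in
/-- A Følner set. -/
noncomputable def box (w : ℤ → ℤ) (N : ℕ) : Finset (HallGroup w) :=
  (boxParameters N).image (boxElement w N)

open Classical in
theorem card_box (N : ℕ) : (box w N).card = (boxParameters N).card :=
  Finset.card_image_of_injective _ (boxElement_injective w N)

open Classical in
theorem card_filter_box_le {N : ℕ} (s : HallGroup w) (B : Finset (ℕ × (Fin N → ℕ) × ℕ))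
    (h : ∀ p ∈ boxParameters N, p ∉ B → s * boxElement w N p ∈ box w N) :
    ((box w N).filter (s * · ∉ box w N)).card ≤ B.card := by
  refine (Finset.card_le_card (t := B.image (boxElement w N)) fun g hg => ?_).trans
    Finset.card_image_le
  obtain ⟨hg, hg'⟩ := Finset.mem_filter.1 hg
  obtain ⟨p, hp, rfl⟩ := Finset.mem_image.1 hg
  exact Finset.mem_image_of_mem _ (by_contra fun hB => hg' (h p hp hB))

open Classical in
theorem card_filter_shiftGen (N : ℕ) :
    N * ((box w N).filter (shiftGen w * · ∉ box w N)).card ≤ (box w N).card := by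
  rw [card_box, card_boxParameters]
  refine Nat.mul_le_mul_left N ((card_filter_box_le (shiftGen w) ({N - 1} ×ˢ
    Fintype.piFinset (fun _ => Finset.range N) ×ˢ Finset.range (N ^ 3)) ?_).trans (by simp))
  rintro ⟨k, u, c⟩ hp hB
  obtain ⟨hk, hu, hc⟩ := mem_boxParameters.1 hp
  rw [shiftGen_mul_boxElement]
  refine Finset.mem_image_of_mem _ (mem_boxParameters.2 ⟨?_, hu, hc⟩)
  simp only [Finset.mem_product, Finset.mem_singleton, Fintype.mem_piFinset, Finset.mem_range] at *
  have : k ≠ N - 1 := fun h => hB ⟨h, hu, hc⟩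
  omega

open Classical in
theorem card_filter_lampGen (hw : ∀ n, 0 ≤ w n ∧ w n ≤ 1) (N : ℕ) :
    N * ((box w N).filter (lampGen w * · ∉ box w N)).card ≤ 2 * (box w N).card := by
  -- The box can be left in two ways: the lamp at the origin already has its maximal value (`B₁`),
  -- or the central coordinate is within `N ^ 2` of its upper end (`B₂`). Each has proportion at
  -- most `1 / N`.
  set B₁ : Finset (ℕ × (Fin N → ℕ) × ℕ) :=
    (boxParameters N).filter fun p => ∃ h : p.1 < N, p.2.1 ⟨p.1, h⟩ + 1 = N
  set B₂ : Finset (ℕ × (Fin N → ℕ) × ℕ) := Finset.range N ×ˢ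
    Fintype.piFinset (fun _ => Finset.range N) ×ˢ Finset.Ico (N ^ 3 - N ^ 2) (N ^ 3)
  have h1 : N * B₁.card ≤ (boxParameters N).card := by
    have hcard : N * B₁.card = (B₁ ×ˢ Finset.range N).card := by
      rw [Finset.card_product, Finset.card_range, mul_comm]
    rw [hcard]
    -- On `B₁` the lamp at the origin is known to be `N - 1`, so overwriting it by `j` loses no
    -- information.
    let f (q : (ℕ × (Fin N → ℕ) × ℕ) × ℕ) : ℕ × (Fin N → ℕ) × ℕ :=
      (q.1.1, fun i => if (i : ℕ) = q.1.1 then q.2 else q.1.2.1 i, q.1.2.2)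
    refine Finset.card_le_card_of_injOn f ?_ ?_
    · rintro ⟨⟨k, u, c⟩, j⟩ hq
      obtain ⟨hp, hj⟩ := Finset.mem_product.1 hq
      obtain ⟨hk, hu, hc⟩ := mem_boxParameters.1 (Finset.mem_filter.1 hp).1
      refine mem_boxParameters.2 ⟨hk, fun i => ?_, hc⟩
      have := hu i
      have := Finset.mem_range.1 hj
      simp only [f]
      split_ifs <;> assumption
    · rintro ⟨⟨k, u, c⟩, j⟩ hq ⟨⟨k', u', c'⟩, j'⟩ hq' he
      obtain ⟨hk, hu⟩ := (Finset.mem_filter.1 (Finset.mem_product.1 hq).1).2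
      obtain ⟨hk', hu'⟩ := (Finset.mem_filter.1 (Finset.mem_product.1 hq').1).2
      simp only [f, Prod.mk.injEq] at he hu hu' hk hk' ⊢
      obtain ⟨rfl, he, rfl⟩ := he
      refine ⟨⟨rfl, funext fun i => ?_, rfl⟩, by simpa using congrFun he ⟨k, hk⟩⟩
      by_cases hi : (i : ℕ) = k
      · have : i = ⟨k, hk⟩ := Fin.ext hi
        subst this
        omega
      · simpa [hi] using congrFun he i
  have h2 : N * B₂.card ≤ (boxParameters N).card := by
    rw [card_boxParameters]
    simp only [B₂, Finset.card_product, Finset.card_range, Fintype.card_piFinset_const,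
      Nat.card_Ico]
    calc N * (N * (N ^ N * (N ^ 3 - (N ^ 3 - N ^ 2)))) ≤ N * (N * (N ^ N * N ^ 2)) := by
          gcongr
          omega
      _ = _ := by ring
  have h3 : ((box w N).filter (lampGen w * · ∉ box w N)).card ≤ (B₁ ∪ B₂).card := by
    refine card_filter_box_le _ _ ?_
    rintro ⟨k, u, c⟩ hp hB
    obtain ⟨hk, hu, hc⟩ := mem_boxParameters.1 hp
    simp only at hk hu hc
    obtain ⟨d, hd, he⟩ := lampGen_mul_boxElement hw hk u c hu
    rw [he]
    rw [Finset.mem_union, not_or] at hB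
    refine Finset.mem_image_of_mem _ (mem_boxParameters.2 ⟨hk, fun i => ?_, ?_⟩)
    · have h4 : u ⟨k, hk⟩ + 1 ≠ N := fun h => hB.1 (Finset.mem_filter.2 ⟨hp, hk, h⟩)
      have h5 := hu ⟨k, hk⟩
      have h6 := hu i
      simp only [Function.update_apply]
      split_ifs <;> omega
    · have h4 : ¬ N ^ 3 - N ^ 2 ≤ c := fun h => hB.2 (by
        simpa [B₂, hk, hc, hu] using h)
      simp only
      omega
  have h4 := Finset.card_union_le B₁ B₂
  rw [card_box]
  nlinarith [Nat.mul_le_mul_left N (h3.trans h4)]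

open Classical in
theorem exists_almostInvariant (hw : ∀ n, 0 ≤ w n ∧ w n ≤ 1) (ε : ℝ) (hε : 0 < ε) :
    ∃ F : Finset (HallGroup w), F.Nonempty ∧
      (F.filter (shiftGen w * · ∉ F)).card ≤ ε * F.card ∧
      (F.filter (lampGen w * · ∉ F)).card ≤ ε * F.card := by
  obtain ⟨N, hN⟩ := exists_nat_gt (2 / ε)
  have hN0 : (0 : ℝ) < N := lt_trans (by positivity) hN
  have hN1 : 0 < N := by exact_mod_cast hN0
  rw [div_lt_iff₀ hε] at hN
  have key (x : ℕ) (h : N * x ≤ 2 * (box w N).card) : (x : ℝ) ≤ ε * (box w N).card := by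
    have h' : (N : ℝ) * x ≤ 2 * (box w N).card := by exact_mod_cast h
    refine le_of_mul_le_mul_left (h'.trans ?_) hN0
    rw [← mul_assoc]
    gcongr
  refine ⟨box w N, ?_, key _ ((card_filter_shiftGen N).trans (by omega)),
    key _ (card_filter_lampGen hw N)⟩
  rw [← Finset.card_pos, card_box, card_boxParameters]
  positivity

/-! ### The spectrum of the Hall groups -/

/-- The homomorphism to the integers sending both generators to `1`. -/
noncomputable def lengthHom (w : ℤ → ℤ) : HallGroup w →* Multiplicative ℤ where
  toFun g := .ofAdd (g.shift + LaurentPolynomial.eval₂ (RingHom.id ℤ) 1 g.poly)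
  map_one' := by simp
  -- Evaluating at `1` forgets the shift action, since `T` goes to `1`.
  map_mul' g h := by
    rw [← ofAdd_add]
    congr 1
    simp only [shift_mul, poly_mul, map_add, map_mul, LaurentPolynomial.eval₂_T, one_zpow,
      Units.val_one, mul_one]
    ring

theorem lengthHom_shiftGen : lengthHom w (shiftGen w) = .ofAdd 1 := by
  simp [lengthHom, shiftGen]

theorem lengthHom_lampGen : lengthHom w (lampGen w) = .ofAdd 1 := by
  simp [lengthHom, lampGen]

theorem groupSpectrum_symmetricPair (hw : ∀ n, 0 ≤ w n ∧ w n ≤ 1) :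
    groupSpectrum (symmetricPair (shiftGen w) (lampGen w)) =
      Complex.ofReal '' Set.Icc (-1 : ℝ) 1 := by
  classical
  refine (groupSpectrum_subset (inv_mem_symmetricPair _ _)).antisymm ?_
  rintro _ ⟨x, hx, rfl⟩
  let z : Circle := Circle.exp (Real.arccos x)
  let χ : HallGroup w →* Circle := (zpowersHom Circle z).comp (lengthHom w)
  have hs : χ (shiftGen w) = z := by simp [χ, lengthHom_shiftGen]
  have hl : χ (lampGen w) = z := by simp [χ, lengthHom_lampGen]
  have hz : (z : ℂ).re = x := by
    rw [Circle.coe_exp, Complex.exp_ofReal_mul_I_re, Real.cos_arccos hx.1 hx.2]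
  have hne {a b : HallGroup w} (ha : lengthHom w a = .ofAdd 1) (hb : lengthHom w b = .ofAdd 1) :
      a ≠ b⁻¹ := by
    rintro rfl
    rw [map_inv, hb] at ha
    exact absurd (congrArg Multiplicative.toAdd ha) (by simp)
  have h := re_mem_groupSpectrum_of_almostInvariant (hne lengthHom_shiftGen lengthHom_shiftGen)
    (fun h => by simpa [shiftGen, lampGen] using congr(($h).shift))
    (hne lengthHom_shiftGen lengthHom_lampGen) (hne lengthHom_lampGen lengthHom_lampGen) χ
    (hs.trans hl.symm) (exists_almostInvariant hw)
  rwa [hs, hz] at h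

end HallGroup

/-! ### Encoding sets of natural numbers, and counting isomorphism classes -/

open Classical in
/-- The indicator function of `{1} ∪ (A + 3)`. -/
noncomputable def hallWeight (A : Set ℕ) (n : ℤ) : ℤ :=
  if n = 1 ∨ ∃ m ∈ A, n = m + 3 then 1 else 0

theorem hallWeight_nonneg_le_one (A : Set ℕ) (n : ℤ) : 0 ≤ hallWeight A n ∧ hallWeight A n ≤ 1 := by
  unfold hallWeight
  split_ifs <;> simp

/-- The values at `1`, `2` and negative integers are the same for all `A`: they ensure generation by
two elements and derived length three. The set `A` is encoded from `3` on. -/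
theorem hallWeight_one (A : Set ℕ) : hallWeight A 1 = 1 := if_pos (.inl rfl)

theorem hallWeight_two (A : Set ℕ) : hallWeight A 2 = 0 := by
  refine if_neg ?_
  rintro (h | ⟨m, -, h⟩) <;> omega

theorem hallWeight_of_neg (A : Set ℕ) {n : ℤ} (hn : n < 0) : hallWeight A n = 0 := by
  refine if_neg ?_
  rintro (h | ⟨m, -, h⟩) <;> omega

theorem hallWeight_add_three (A : Set ℕ) (m : ℕ) : hallWeight A (m + 3) ≠ 0 ↔ m ∈ A := by
  unfold hallWeight
  split_ifs with h
  · obtain h | ⟨k, hk, h⟩ := h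
    · omega
    · have : m = k := by omega
      simp [this, hk]
  · simp only [ne_eq, not_true_eq_false, false_iff]
    exact fun hm => h (.inr ⟨m, hm, rfl⟩)

/-- The set of shifts `m + 3` by which the conjugate of `b` by a power of `a` does not commute
with `b`. -/
def noncommutingShifts {G : Type*} [Group G] (a b : G) : Set ℕ :=
  {m | ¬Commute b (a ^ (m + 3 : ℤ) * b * (a ^ (m + 3 : ℤ))⁻¹)}

theorem noncommutingShifts_map {G H : Type*} [Group G] [Group H] (e : G ≃* H) (a b : G) :
    noncommutingShifts (e a) (e b) = noncommutingShifts a b := by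
  ext m
  simp only [noncommutingShifts, Set.mem_ofPred_eq, ← map_zpow, ← map_mul, ← map_inv]
  rw [commute_iff_eq, commute_iff_eq, ← map_mul, ← map_mul, e.apply_eq_iff_eq]

theorem noncommutingShifts_hallGroup (A : Set ℕ) :
    noncommutingShifts (HallGroup.shiftGen (hallWeight A)) (HallGroup.lampGen _) = A := by
  ext m
  rw [noncommutingShifts, Set.mem_ofPred_eq, HallGroup.commute_lampGen_iff,
    hallWeight_of_neg A (n := -(m + 3 : ℤ)) (by omega)]
  exact hallWeight_add_three A m

theorem countable_setOf_nonempty_mulEquiv (A : Set ℕ) :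
    {B : Set ℕ | Nonempty (HallGroup (hallWeight A) ≃* HallGroup (hallWeight B))}.Countable := by
  refine (Set.countable_range fun p : HallGroup (hallWeight A) × HallGroup (hallWeight A) =>
    noncommutingShifts p.1 p.2).mono ?_
  rintro B ⟨e⟩
  refine ⟨(e.symm (HallGroup.shiftGen _), e.symm (HallGroup.lampGen _)), ?_⟩
  exact (noncommutingShifts_map e.symm _ _).trans (noncommutingShifts_hallGroup B)

/-- Isomorphism of the groups attached to sets of natural numbers. -/
def hallSetoid : Setoid (Set ℕ) where
  r A B := Nonempty (HallGroup (hallWeight A) ≃* HallGroup (hallWeight B))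
  iseqv := ⟨fun _ => ⟨.refl _⟩, fun ⟨e⟩ => ⟨e.symm⟩, fun ⟨e⟩ ⟨f⟩ => ⟨e.trans f⟩⟩

theorem mk_quotient_hallSetoid : Cardinal.mk (Quotient hallSetoid) = Cardinal.continuum := by
  have hset : Cardinal.mk (Set ℕ) = Cardinal.continuum := by
    rw [Cardinal.mk_set, Cardinal.mk_nat, Cardinal.two_power_aleph0]
  refine le_antisymm (hset ▸ Cardinal.mk_quotient_le) ?_
  -- The fibres of the quotient map are countable, and a product of `aleph0` with a cardinal below
  -- the continuum stays below it.
  have h : Cardinal.mk (Set ℕ) ≤ Cardinal.mk (Quotient hallSetoid) * Cardinal.aleph0 := by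
    refine Cardinal.mk_le_mk_mul_of_mk_preimage_le (Quotient.mk hallSetoid) fun q => ?_
    refine Cardinal.le_aleph0_iff_set_countable.2
      ((countable_setOf_nonempty_mulEquiv q.out).mono fun B hB => ?_)
    exact Quotient.exact ((Quotient.out_eq q).trans hB.symm)
  rw [hset] at h
  by_contra! hlt
  exact absurd h (not_le.2 (Cardinal.mul_lt_of_lt Cardinal.aleph0_le_continuum hlt
    Cardinal.aleph0_lt_continuum))

theorem theorem4 :
    ∃ (ι : Type) (G : ι → Type) (_ : ∀ i, Group (G i)),
      Cardinal.mk ι = Cardinal.continuum ∧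
      (∀ i j, i ≠ j → IsEmpty (G i ≃* G j)) ∧
      ∀ i, IsTorsionFreeGroup (G i) ∧
        derivedSeries (G i) 3 = ⊥ ∧ derivedSeries (G i) 2 ≠ ⊥ ∧
        ∃ a b : G i, Subgroup.closure {a, b} = ⊤ ∧
          groupSpectrum (symmetricPair a b) = Complex.ofReal '' Set.Icc (-1 : ℝ) 1 := by
  refine ⟨Quotient hallSetoid, fun q => HallGroup (hallWeight q.out), fun _ => inferInstance,
    mk_quotient_hallSetoid, fun i j hij => ⟨fun e => hij ?_⟩, fun i =>
      ⟨HallGroup.isTorsionFreeGroup, HallGroup.derivedSeries_three,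
        HallGroup.derivedSeries_two_ne_bot ?_, HallGroup.shiftGen _, HallGroup.lampGen _,
        HallGroup.closure_eq_top ?_,
        HallGroup.groupSpectrum_symmetricPair (hallWeight_nonneg_le_one _)⟩⟩
  · rw [← i.out_eq, ← j.out_eq]
    exact Quotient.sound ⟨e⟩
  · simp [hallWeight_one, hallWeight_two, hallWeight_of_neg]
  · simp [hallWeight_one, hallWeight_of_neg]
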